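/- Let $n\ge 2$ and let $A_n=\{a_1,\dots,a_n\}$. An $n$-ary Cantor algebra is a set with unary operations $\alpha_1,\dots,\alpha_n$ and an $n$-ary operation $\lambda$, all written to the right of their arguments, such that $(z\alpha_1,\dots,z\alpha_n)\lambda=z$ and $(z_1,\dots,z_n)\lambda\alpha_i=z_i$ for all $i$. *The algebra $\mathscr T_n$.* Let $M_n$ be the set of surjective morphisms between finitely generated right ideals of the free monoid $A_n^*$ (maps with $\theta(rs)=\theta(r)s$), together with the empty function $0$, ordered by restriction of functions. For $a,b\in M_n$ write $a\equiv b$ if for every $0<z\le a$ there is $0<z'\le z$ with $z'\le b$, and for every $0<z\le b$ there is $0<z'\le z$ with $z'\le a$. The operations $f\alpha_i\colon w\mapsto f(a_iw)$ and $(f_1,\dots,f_n)\lambda\colon a_iw\mapsto f_i(w)$ on $M_n$ induce operations on $M_n/{\equiv}$. Let $\mathscr T_n$ be the set of classes of those $f\in M_n$ for which the identity map on the domain of $f$ is $\equiv$-related to the identity map on $A_n^*$. It is closed under these operations and is an $n$-ary Cantor algebra. *Standard symbols.* A prefix code is a finite set of pairwise prefix-incomparable strings; it is maximal if every string is prefix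 comparable with one of its elements. A symbol $\left(\frac XY\right)$ consists of a prefix code $X=\{x_1,\dots,x_m\}$ and strings $Y=(y_1,\dots,y_m)$, $y_j$ being matched with $x_j$. It determines the map $x_ju\mapsto y_ju$ in $M_n$, whose class lies in $\mathscr T_n$ if $X$ is maximal. A standard symbol is a symbol with $X$ maximal for which there are no strings $p,q$ such that, for every $i$, $pa_i\in X$ and $pa_i$ is matched with $qa_i$. *Standard forms.* Higman's standard forms over $\{x\}$ are the following formal words: $x\alpha_{i_1}\cdots\alpha_{i_k}$ with $k\ge 0$; and, whenever $w_1,\dots,w_n$ are standard forms, $w_1\cdots w_n\lambda$, unless there is a standard form $u$ such that $w_i$ is the word $u\alpha_i$ for all $i$. They form an $n$-ary Cantor algebra: applied to $w$, the operation $\alpha_i$ gives $w_i$ if $w$ is the word $w_1\cdots w_n\lambda$, and the word $w\alpha_i$ otherwise; applied to $w_1,\dots,w_n$, the operation $\lambda$ gives $u$ if $w_i$ is the word $u\alpha_i$ for all $i$, and the word $w_1\cdots w_n\lambda$ otherwise. **Theorem.** There is an isomorphism $\Phi$ of $n$-ary Cantor algebras from $\mathscr T_n$ to Higman's $n$-ary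 Cantor algebra of standard forms over $\{x\}$. In particular, the standard symbols are in bijective correspondence with the standard forms over $\{x\}$: the map $\Psi$ which sends a standard symbol to the image under $\Phi$ of the element of $\mathscr T_n$ that it represents is a bijection. Moreover $\Psi\left(\frac XY\right)$ is obtained by prefixing the labels by $x$: for each $x_j\in X$, $x_j=a_{i_1}\cdots a_{i_k}$, with matched string $y_j=a_{l_1}\cdots a_{l_r}$, the subword of $\Psi\left(\frac XY\right)$ reached by successively passing to the $i_1$-th, ..., $i_k$-th argument of $\lambda$ is $x\alpha_{l_1}\cdots\alpha_{l_r}$. -/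

import Mathlib

/-- An `n`-ary Cantor algebra: `n` unary operations `α i` and one `n`-ary operation `lam`
satisfying (CA1) and (CA2). -/
class CantorAlgebra (n : ℕ) (C : Type*) where
  α : Fin n → C → C
  lam : (Fin n → C) → C
  lam_α : ∀ x : C, lam (fun i => α i x) = x
  α_lam : ∀ (x : Fin n → C) (i : Fin n), α i (lam x) = x i

/-- Isomorphisms of `n`-ary Cantor algebras. -/
structure CantorIso (n : ℕ) (C D : Type*) [CantorAlgebra n C] [CantorAlgebra n D]
    extends C ≃ D where
  map_α : ∀ (i : Fin n) (x : C),
    toFun (CantorAlgebra.α i x) = CantorAlgebra.α i (toFun x)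
  map_lam : ∀ x : Fin n → C,
    toFun (CantorAlgebra.lam x) = CantorAlgebra.lam (fun i => toFun (x i))

/-- The free monoid on the alphabet with `n` letters, as strings; the empty string is `[]` and
`x <+: y` says that `x` is a prefix of `y`. -/
abbrev Str (n : ℕ) := List (Fin n)

/-! ### The monoid of morphisms between finitely generated right ideals -/

/-- Surjective morphisms between finitely generated right ideals of the free monoid, together with
the empty function, as partial functions (`toFun w = none` means that `w` is not in the domain).
The domain is the right ideal generated by a finite set, and the function is a morphism of right
ideals; its range is then automatically the right ideal generated by the images of the generators
of its domain, and the function is regarded as a surjection onto that range. -/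
@[ext]
structure FGMor (n : ℕ) where
  toFun : Str n → Option (Str n)
  map_append : ∀ w v u, toFun w = some v → toFun (w ++ u) = some (v ++ u)
  fg : ∃ X : Finset (Str n), ∀ w, (∃ v, toFun w = some v) ↔ ∃ x ∈ X, x <+: w

namespace FGMor

variable {n : ℕ}

/-- `f` is nonzero: it is not the empty function. -/
def NonZero (f : FGMor n) : Prop := ∃ w v, f.toFun w = some v

/-- The natural partial order (`a = b a*`): `a` is a restriction of `b`. -/
def Le (a b : FGMor n) : Prop := ∀ w v, a.toFun w = some v → b.toFun w = some v

/-- The relation `≡`: below every nonzero element below one of the two there is a nonzero element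
that is also below the other. -/
def Equiv (a b : FGMor n) : Prop :=
  (∀ x : FGMor n, x.NonZero → x.Le a → ∃ z : FGMor n, z.NonZero ∧ z.Le x ∧ z.Le b) ∧
  (∀ y : FGMor n, y.NonZero → y.Le b → ∃ z : FGMor n, z.NonZero ∧ z.Le y ∧ z.Le a)

/-- The projection `f*`: the identity function on the domain of `f`. -/
def star (f : FGMor n) : FGMor n where
  toFun w := (f.toFun w).map (fun _ => w)
  map_append w v u h := by
    simp only [Option.map_eq_some_iff] at h ⊢
    obtain ⟨a, ha, rfl⟩ := h
    exact ⟨a ++ u, f.map_append _ _ _ ha, rfl⟩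
  fg := by
    obtain ⟨X, hX⟩ := f.fg
    refine ⟨X, fun w => ?_⟩
    rw [← hX]
    simp [Option.map_eq_some_iff]

/-- The identity function on the free monoid. -/
def one : FGMor n where
  toFun w := some w
  map_append w v u h := by
    simp only [Option.some.injEq] at h ⊢
    rw [h]
  fg := ⟨{[]}, fun w => by simp⟩

/-- The unary operation `α i`: the composite of `f` with `w ↦ a_i w`. On symbols it sends `X/Y` to
`(a_i⁻¹X)/Y` if `X ≠ {ε}` and `ε/y` to `ε/(y a_i)`. -/
def alpha (i : Fin n) (f : FGMor n) : FGMor n where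
  toFun w := f.toFun (i :: w)
  map_append w v u h := f.map_append _ _ _ h
  fg := by
    classical
    obtain ⟨X, hX⟩ := f.fg
    refine ⟨(X.image List.tail).filter (fun t => i :: t ∈ X ∨ [] ∈ X), fun w => ?_⟩
    rw [hX]
    constructor
    · rintro ⟨x, hx, hp⟩
      rcases x with _ | ⟨j, t⟩
      · exact ⟨[], by simpa [hx] using ⟨[], hx, rfl⟩, by simp⟩
      · rw [List.cons_prefix_cons] at hp
        obtain ⟨rfl, hp⟩ := hp
        exact ⟨t, Finset.mem_filter.2 ⟨Finset.mem_image.2 ⟨_, hx, rfl⟩, Or.inl hx⟩, hp⟩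
    · rintro ⟨t, ht, hp⟩
      rcases (Finset.mem_filter.1 ht).2 with h | h
      · exact ⟨i :: t, h, by rw [List.cons_prefix_cons]; exact ⟨rfl, hp⟩⟩
      · exact ⟨[], h, by simp⟩

/-- The `n`-ary operation: `a_i w ↦ f_i w`, undefined at the empty string. On symbols it sends
`X₁/Y₁, …, X_n/Y_n` to `(a₁X₁ ∪ ⋯ ∪ a_nX_n)/(Y₁ ∪ ⋯ ∪ Y_n)`. -/
def lam (f : Fin n → FGMor n) : FGMor n where
  toFun
    | [] => none
    | i :: w => (f i).toFun w
  map_append w v u h := by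
    rcases w with _ | ⟨i, w⟩
    · cases h
    · exact (f i).map_append _ _ _ h
  fg := by
    classical
    choose X hX using fun i => (f i).fg
    refine ⟨Finset.univ.biUnion (fun i => (X i).image (List.cons i)), fun w => ?_⟩
    rcases w with _ | ⟨i, w⟩
    · simp
    · simp only [Finset.mem_biUnion, Finset.mem_univ, true_and, Finset.mem_image]
      rw [hX i w]
      constructor
      · rintro ⟨x, hx, hp⟩
        exact ⟨i :: x, ⟨i, x, hx, rfl⟩, by rw [List.cons_prefix_cons]; exact ⟨rfl, hp⟩⟩
      · rintro ⟨_, ⟨j, x, hx, rfl⟩, hp⟩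
        rw [List.cons_prefix_cons] at hp
        obtain ⟨rfl, hp⟩ := hp
        exact ⟨x, hx, hp⟩

/-- The morphism `y x⁻¹`, which sends `x u` to `y u`. -/
def single (x y : Str n) : FGMor n where
  toFun w := if x <+: w then some (y ++ w.drop x.length) else none
  map_append w v u h := by
    split_ifs at h with hx
    · cases h
      rw [if_pos (hx.trans (List.prefix_append _ _)), List.drop_append_of_le_length hx.length_le,
        List.append_assoc]
  fg := ⟨{x}, fun w => by simp⟩

theorem single_self (x y : Str n) : (single x y).toFun x = some y := by
  simp [single]

theorem single_le {f : FGMor n} {x y : Str n} (h : f.toFun x = some y) : (single x y).Le f := by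
  intro w v hw
  simp only [single] at hw
  split_ifs at hw with hx
  · cases hw
    obtain ⟨u, rfl⟩ := hx
    simpa using f.map_append _ _ u h

theorem equiv_iff {a b : FGMor n} : a.Equiv b ↔
    (∀ w v, a.toFun w = some v → ∃ u, b.toFun (w ++ u) = some (v ++ u)) ∧
    (∀ w v, b.toFun w = some v → ∃ u, a.toFun (w ++ u) = some (v ++ u)) := by
  have key : ∀ a b : FGMor n,
      (∀ x : FGMor n, x.NonZero → x.Le a → ∃ z : FGMor n, z.NonZero ∧ z.Le x ∧ z.Le b) ↔
      (∀ w v, a.toFun w = some v → ∃ u, b.toFun (w ++ u) = some (v ++ u)) := by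
    intro a b
    constructor
    · intro h w v hw
      obtain ⟨z, ⟨p, q, hpq⟩, h1, h2⟩ :=
        h (single w v) ⟨w, v, single_self w v⟩ (single_le hw)
      have h3 := h1 _ _ hpq
      simp only [single] at h3
      split_ifs at h3 with hx
      · obtain ⟨u, rfl⟩ := hx
        simp only [List.drop_left, Option.some.injEq] at h3
        exact ⟨u, by rw [h3]; exact h2 _ _ hpq⟩
    · rintro h x ⟨w, v, hw⟩ hx
      obtain ⟨u, hu⟩ := h w v (hx _ _ hw)
      exact ⟨single (w ++ u) (v ++ u), ⟨_, _, single_self _ _⟩,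
        single_le (x.map_append _ _ _ hw), single_le hu⟩
  exact and_congr (key a b) (key b a)

theorem Equiv.refl (a : FGMor n) : a.Equiv a :=
  ⟨fun x h h' => ⟨x, h, fun _ _ h => h, h'⟩, fun x h h' => ⟨x, h, fun _ _ h => h, h'⟩⟩

theorem Equiv.symm {a b : FGMor n} (h : a.Equiv b) : b.Equiv a := ⟨h.2, h.1⟩

theorem Equiv.trans {a b c : FGMor n} (h : a.Equiv b) (h' : b.Equiv c) : a.Equiv c := by
  rw [equiv_iff] at *
  refine ⟨fun w v hw => ?_, fun w v hw => ?_⟩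
  · obtain ⟨u, hu⟩ := h.1 _ _ hw
    obtain ⟨u', hu'⟩ := h'.1 _ _ hu
    exact ⟨u ++ u', by simpa [List.append_assoc] using hu'⟩
  · obtain ⟨u, hu⟩ := h'.2 _ _ hw
    obtain ⟨u', hu'⟩ := h.2 _ _ hu
    exact ⟨u ++ u', by simpa [List.append_assoc] using hu'⟩

theorem Equiv.alpha {a b : FGMor n} (h : a.Equiv b) (i : Fin n) :
    (a.alpha i).Equiv (b.alpha i) := by
  rw [equiv_iff] at *
  exact ⟨fun w v hw => h.1 (i :: w) v hw, fun w v hw => h.2 (i :: w) v hw⟩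

theorem Equiv.lam {a b : Fin n → FGMor n} (h : ∀ i, (a i).Equiv (b i)) :
    (FGMor.lam a).Equiv (FGMor.lam b) := by
  simp only [equiv_iff] at *
  constructor
  · rintro (_ | ⟨i, w⟩) v hw
    · cases hw
    · exact (h i).1 w v hw
  · rintro (_ | ⟨i, w⟩) v hw
    · cases hw
    · exact (h i).2 w v hw

theorem star_apply {a : FGMor n} {w v : Str n} :
    a.star.toFun w = some v ↔ v = w ∧ ∃ y, a.toFun w = some y := by
  simp only [star, Option.map_eq_some_iff]
  constructor
  · rintro ⟨y, hy, rfl⟩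
    exact ⟨rfl, y, hy⟩
  · rintro ⟨rfl, y, hy⟩
    exact ⟨y, hy, rfl⟩

theorem Equiv.star {a b : FGMor n} (h : a.Equiv b) : a.star.Equiv b.star := by
  rw [equiv_iff] at *
  simp only [star_apply]
  constructor
  · rintro w v ⟨rfl, y, hy⟩
    obtain ⟨u, hu⟩ := h.1 _ _ hy
    exact ⟨u, rfl, _, hu⟩
  · rintro w v ⟨rfl, y, hy⟩
    obtain ⟨u, hu⟩ := h.2 _ _ hy
    exact ⟨u, rfl, _, hu⟩

theorem star_equiv_one_iff {a : FGMor n} :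
    a.star.Equiv one ↔ ∀ w, ∃ u v, a.toFun (w ++ u) = some v := by
  rw [equiv_iff]
  simp only [star_apply]
  constructor
  · rintro ⟨-, h⟩ w
    obtain ⟨u, -, y, hy⟩ := h w w rfl
    exact ⟨u, y, hy⟩
  · intro h
    refine ⟨fun w v hw => ⟨[], by simp [one, hw.1]⟩, fun w v hw => ?_⟩
    simp only [one, Option.some.injEq] at hw
    subst hw
    obtain ⟨u, y, hy⟩ := h w
    exact ⟨u, rfl, y, hy⟩

instance setoid (n : ℕ) : Setoid (FGMor n) :=
  ⟨Equiv, Equiv.refl, Equiv.symm, Equiv.trans⟩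

end FGMor

/-! ### The quotient by `≡` and its total elements -/

/-- The quotient of the monoid of morphisms by `≡`. -/
def CMon (n : ℕ) := Quotient (FGMor.setoid n)

namespace CMon

variable {n : ℕ}

def mk (f : FGMor n) : CMon n := Quotient.mk _ f

def star : CMon n → CMon n := Quotient.map FGMor.star fun _ _ h => FGMor.Equiv.star h

def one : CMon n := mk FGMor.one

def alpha (i : Fin n) : CMon n → CMon n :=
  Quotient.map (FGMor.alpha i) fun _ _ h => FGMor.Equiv.alpha h i

/-- Defined through representatives, on whose choice it does not depend (`lam_mk`). -/
noncomputable def lam (c : Fin n → CMon n) : CMon n := mk (FGMor.lam fun i => (c i).out)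

theorem alpha_mk (i : Fin n) (f : FGMor n) : alpha i (mk f) = mk (f.alpha i) := rfl

theorem star_mk (f : FGMor n) : star (mk f) = mk f.star := rfl

theorem mk_eq_iff {f g : FGMor n} : mk f = mk g ↔ f.Equiv g := Quotient.eq

theorem lam_mk (f : Fin n → FGMor n) : lam (fun i => mk (f i)) = mk (FGMor.lam f) :=
  mk_eq_iff.2 (FGMor.Equiv.lam fun i => Quotient.exact (Quotient.out_eq (mk (f i))))

theorem exists_rep (c : CMon n) : ∃ f, mk f = c := Quotient.exists_rep c

end CMon

/-- The algebra of total maps: the elements whose projection `f*` is the identity. -/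
def TAlg (n : ℕ) := {c : CMon n // c.star = CMon.one}

namespace TAlg

variable {n : ℕ}

theorem star_alpha (i : Fin n) (c : CMon n) (h : c.star = CMon.one) :
    (c.alpha i).star = CMon.one := by
  obtain ⟨f, rfl⟩ := c.exists_rep
  rw [CMon.star_mk, CMon.one, CMon.mk_eq_iff, FGMor.star_equiv_one_iff] at h
  rw [CMon.alpha_mk, CMon.star_mk, CMon.one, CMon.mk_eq_iff, FGMor.star_equiv_one_iff]
  exact fun w => h (i :: w)

theorem star_lam [n.AtLeastTwo] (c : Fin n → CMon n) (h : ∀ i, (c i).star = CMon.one) :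
    (CMon.lam c).star = CMon.one := by
  choose f hf using fun i => (c i).exists_rep
  obtain rfl : (fun i => CMon.mk (f i)) = c := funext hf
  simp only [CMon.star_mk, CMon.one, CMon.mk_eq_iff, FGMor.star_equiv_one_iff] at h
  rw [CMon.lam_mk, CMon.star_mk, CMon.one, CMon.mk_eq_iff, FGMor.star_equiv_one_iff]
  rintro (_ | ⟨i, w⟩)
  · have hn : 2 ≤ n := Nat.AtLeastTwo.prop
    obtain ⟨u, v, huv⟩ := h ⟨0, by omega⟩ []
    exact ⟨⟨0, by omega⟩ :: u, v, huv⟩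
  · exact h i w

noncomputable instance [n.AtLeastTwo] : CantorAlgebra n (TAlg n) where
  α i f := ⟨f.1.alpha i, star_alpha i f.1 f.2⟩
  lam f := ⟨CMon.lam fun i => (f i).1, star_lam _ fun i => (f i).2⟩
  lam_α := by
    rintro ⟨c, hc⟩
    apply Subtype.ext
    obtain ⟨f, rfl⟩ := c.exists_rep
    simp only [CMon.alpha_mk, CMon.lam_mk]
    rw [CMon.mk_eq_iff, FGMor.equiv_iff]
    have hn : 2 ≤ n := Nat.AtLeastTwo.prop
    refine ⟨fun w v hw => ⟨[], ?_⟩, fun w v hw => ⟨[⟨0, by omega⟩], ?_⟩⟩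
    · rcases w with _ | ⟨i, w⟩
      · cases hw
      · simpa [FGMor.lam, FGMor.alpha] using hw
    · have := f.map_append _ _ [⟨0, by omega⟩] hw
      rcases w with _ | ⟨i, w⟩ <;> exact this
  α_lam := by
    intro x i
    apply Subtype.ext
    choose f hf using fun i => (x i).1.exists_rep
    change CMon.alpha i (CMon.lam fun i => (x i).1) = (x i).1
    simp only [← hf]
    rw [CMon.lam_mk, CMon.alpha_mk]
    rfl

end TAlg

/-! ### Symbols -/

/-- Finite sets of pairwise prefix incomparable strings; the empty set is allowed. -/
def IsPrefixCode {n : ℕ} (X : Finset (Str n)) : Prop :=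
  ∀ x ∈ X, ∀ y ∈ X, x <+: y → x = y

/-- Maximal prefix codes: every string is prefix comparable with some element. -/
def IsMaxPrefixCode {n : ℕ} (X : Finset (Str n)) : Prop :=
  IsPrefixCode X ∧ ∀ w : Str n, ∃ x ∈ X, x <+: w ∨ w <+: x

/-- A symbol `X/Y`: a finite prefix code `X = {x₁, …, x_m}` and a family `Y = {y₁, …, y_m}` of
strings, where `y_i = label x_i` is matched with `x_i`. -/
structure Symb (n : ℕ) where
  code : Finset (Str n)
  isPrefixCode : IsPrefixCode code
  label : {x // x ∈ code} → Str n

namespace Symb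

variable {n : ℕ}

open Classical in
/-- The partial function `F(X/Y)`, which sends `x_i u` to `y_i u`. -/
noncomputable def toMor (s : Symb n) : FGMor n where
  toFun w := if h : ∃ x ∈ s.code, x <+: w then
    some (s.label ⟨h.choose, h.choose_spec.1⟩ ++ w.drop h.choose.length) else none
  map_append w v u h := by
    split_ifs at h with hx
    cases h
    have hx' : ∃ x ∈ s.code, x <+: w ++ u :=
      ⟨_, hx.choose_spec.1, hx.choose_spec.2.trans (List.prefix_append _ _)⟩
    rw [dif_pos hx']
    have hp1 := hx.choose_spec.2
    have hp : hx.choose <+: w ++ u := hp1.trans (List.prefix_append _ _)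
    have heq : hx'.choose = hx.choose := by
      rcases List.prefix_or_prefix_of_prefix hp hx'.choose_spec.2 with h | h
      · exact (s.isPrefixCode _ hx.choose_spec.1 _ hx'.choose_spec.1 h).symm
      · exact s.isPrefixCode _ hx'.choose_spec.1 _ hx.choose_spec.1 h
    have hl : s.label ⟨hx'.choose, hx'.choose_spec.1⟩ = s.label ⟨hx.choose, hx.choose_spec.1⟩ := by
      congr 2
    rw [hl, heq, List.drop_append_of_le_length hp1.length_le, List.append_assoc]
  fg := by
    refine ⟨s.code, fun w => ?_⟩
    by_cases h : ∃ x ∈ s.code, x <+: w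
    · rw [dif_pos h]
      exact ⟨fun _ => h, fun _ => ⟨_, rfl⟩⟩
    · rw [dif_neg h]
      exact ⟨fun h' => by simp at h', fun h' => absurd h' h⟩

theorem toMor_apply (s : Symb n) {x : Str n} (hx : x ∈ s.code) (u : Str n) :
    s.toMor.toFun (x ++ u) = some (s.label ⟨x, hx⟩ ++ u) := by
  have h : ∃ y ∈ s.code, y <+: x ++ u := ⟨x, hx, List.prefix_append _ _⟩
  have heq : h.choose = x := by
    rcases List.prefix_or_prefix_of_prefix (List.prefix_append x u) h.choose_spec.2 with h' | h'
    · exact (s.isPrefixCode _ hx _ h.choose_spec.1 h').symm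
    · exact s.isPrefixCode _ h.choose_spec.1 _ hx h'
  have hl : s.label ⟨h.choose, h.choose_spec.1⟩ = s.label ⟨x, hx⟩ := by congr 2
  simp only [toMor]
  rw [dif_pos h, hl, heq, List.drop_left]

/-- A symbol can be simplified if there are strings `x`, `y` such that, for every letter `a`,
the string `xa` is in the code and is matched with `ya`. -/
def Simplifiable (s : Symb n) : Prop :=
  ∃ x y : Str n, ∀ i : Fin n, ∃ h : x ++ [i] ∈ s.code, s.label ⟨x ++ [i], h⟩ = y ++ [i]

/-- Standard symbols: the code is a maximal prefix code and the symbol cannot be simplified. -/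
def IsStandard (s : Symb n) : Prop := IsMaxPrefixCode s.code ∧ ¬ s.Simplifiable

/-- The element of the algebra of total maps that a symbol over a maximal prefix code represents. -/
noncomputable def toTAlg (s : Symb n) (hs : IsMaxPrefixCode s.code) : TAlg n :=
  ⟨CMon.mk s.toMor, by
    rw [CMon.star_mk, CMon.one, CMon.mk_eq_iff, FGMor.star_equiv_one_iff]
    intro w
    obtain ⟨x, hx, ⟨u, rfl⟩ | ⟨u, rfl⟩⟩ := hs.2 w
    · exact ⟨[], _, by simpa using s.toMor_apply hx u⟩
    · exact ⟨u, _, by simpa using s.toMor_apply hx []⟩⟩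

end Symb

/-- The set of standard symbols. -/
def StdSymb (n : ℕ) := {s : Symb n // s.IsStandard}

/-! ### Higman's standard forms -/

/-- Formal words over a set `X` in `n` unary operation symbols and one `n`-ary operation symbol. -/
inductive HWord (n : ℕ) (X : Type*)
  | var (x : X) : HWord n X
  | app (i : Fin n) (w : HWord n X) : HWord n X
  | lam (w : Fin n → HWord n X) : HWord n X

namespace HWord

variable {n : ℕ} {X : Type*}

/-- The word `x α_{u₁} ⋯ α_{u_k}`. -/
def string (x : X) (u : Str n) : HWord n X := u.foldl (fun w i => app i w) (var x)

/-- Higman's standard forms: the words `x α_{i₁} ⋯ α_{i_k}` with `k ≥ 0` are standard forms, and if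
`w₁, …, w_n` are standard forms then so is `w₁ ⋯ w_n λ`, unless there is a standard form `u` such
that `w_i` is the word `u α_i` for every `i`. (Any word `u` such that the words `u α_i` are standard forms
is itself a standard form, of the form `x α_{i₁} ⋯ α_{i_k}`.) -/
inductive IsStandard : HWord n X → Prop
  | string (x : X) (u : Str n) : IsStandard (HWord.string x u)
  | lam (w : Fin n → HWord n X) (hw : ∀ i, IsStandard (w i))
      (hne : ¬ ∃ u : HWord n X, ∀ i, w i = app i u) :
      IsStandard (HWord.lam w)

/-- The effect of the `i`-th unary operation on words: the `i`-th argument of an outermost `λ` is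
selected; otherwise the symbol `α_i` is appended. -/
def alpha (i : Fin n) : HWord n X → HWord n X
  | lam w => w i
  | w => app i w

open Classical in
/-- The effect of the `n`-ary operation: if the arguments are the words `u α_1, …, u α_n` the value
is `u`; otherwise it is the word `w₁ ⋯ w_n λ`. -/
noncomputable def contract (w : Fin n → HWord n X) : HWord n X :=
  if h : ∃ u : HWord n X, ∀ i, w i = app i u then h.choose else lam w

/-- The subword at an address: descend through outermost `λ`s along the letters of the address. -/
def subwordAt : HWord n X → Str n → Option (HWord n X)
  | w, [] => some w
  | lam w, i :: v => subwordAt (w i) v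
  | var _, _ :: _ => none
  | app _ _, _ :: _ => none

theorem string_append (x : X) (u : Str n) (i : Fin n) :
    string x (u ++ [i]) = app i (string x u) := by
  simp [string]

theorem string_cases (x : X) (u : Str n) :
    string x u = var x ∨ ∃ (i : Fin n) (v : Str n), string x u = app i (string x v) := by
  rcases List.eq_nil_or_concat u with rfl | ⟨v, i, rfl⟩
  · exact Or.inl rfl
  · exact Or.inr ⟨i, v, by rw [List.concat_eq_append, string_append]⟩

theorem alpha_string (i : Fin n) (x : X) (u : Str n) :
    alpha i (string x u) = app i (string x u) := by
  rcases string_cases x u with h | ⟨j, v, h⟩ <;> rw [h] <;> rfl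

theorem IsStandard.of_app {i : Fin n} {w : HWord n X} (h : IsStandard (app i w)) :
    ∃ x u, w = HWord.string x u := by
  generalize hw' : app i w = w' at h
  cases h with
  | string x u =>
    rcases string_cases x u with h | ⟨j, v, h⟩
    · rw [h] at hw'
      cases hw'
    · rw [h] at hw'
      cases hw'
      exact ⟨x, v, rfl⟩
  | lam w hw hne => cases hw'

theorem IsStandard.alpha (i : Fin n) {w : HWord n X} (h : IsStandard w) :
    IsStandard (alpha i w) := by
  cases h with
  | string x u =>
    rw [alpha_string, ← string_append]
    exact .string _ _
  | lam w hw hne => exact hw i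

theorem contract_app [n.AtLeastTwo] (u : HWord n X) : contract (fun i : Fin n => app i u) = u := by
  have h : ∃ u' : HWord n X, ∀ i : Fin n, app i u = app i u' := ⟨u, fun _ => rfl⟩
  have hn : 2 ≤ n := Nat.AtLeastTwo.prop
  rw [contract, dif_pos h]
  have := h.choose_spec ⟨0, by omega⟩
  injection this with _ h2
  exact h2.symm

theorem contract_of_not {w : Fin n → HWord n X} (h : ¬ ∃ u : HWord n X, ∀ i, w i = app i u) :
    contract w = lam w := by
  rw [contract, dif_neg h]

theorem IsStandard.contract [n.AtLeastTwo] {w : Fin n → HWord n X} (hw : ∀ i, IsStandard (w i)) :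
    IsStandard (contract w) := by
  have hn : 2 ≤ n := Nat.AtLeastTwo.prop
  by_cases h : ∃ u : HWord n X, ∀ i, w i = app i u
  · obtain ⟨u, hu⟩ := h
    obtain rfl : w = fun i => app i u := funext hu
    rw [contract_app]
    obtain ⟨x, v, rfl⟩ := (hw ⟨0, by omega⟩).of_app
    exact .string x v
  · rw [contract_of_not h]
    exact .lam w hw h

end HWord

/-- The set of standard forms over `X`. -/
def StdForm (n : ℕ) (X : Type*) := {w : HWord n X // w.IsStandard}

/-- Higman's `n`-ary Cantor algebra of standard forms over `X`. -/
noncomputable instance {n : ℕ} [n.AtLeastTwo] {X : Type*} : CantorAlgebra n (StdForm n X) where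
  α i w := ⟨w.1.alpha i, w.2.alpha i⟩
  lam w := ⟨HWord.contract fun i => (w i).1, HWord.IsStandard.contract fun i => (w i).2⟩
  lam_α := by
    rintro ⟨w, hw⟩
    apply Subtype.ext
    change HWord.contract (fun i => w.alpha i) = w
    cases hw with
    | string x u =>
      simp only [HWord.alpha_string]
      exact HWord.contract_app _
    | lam w hw hne =>
      exact HWord.contract_of_not hne
  α_lam := by
    intro w i
    apply Subtype.ext
    change (HWord.contract fun i => (w i).1).alpha i = (w i).1
    by_cases h : ∃ u : HWord n X, ∀ i, (w i).1 = HWord.app i u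
    · obtain ⟨u, hu⟩ := h
      have h0 := (w i).2
      rw [hu] at h0
      obtain ⟨x, v, rfl⟩ := h0.of_app
      simp only [hu]
      rw [HWord.contract_app, HWord.alpha_string]
    · rw [HWord.contract_of_not h]
      rfl

/-!
Sending the generator `x` to the class of the identity map extends to a map `HWord.eval` from words
to the algebra of total maps, which is a homomorphism on standard forms because both `HWord.alpha`
and `HWord.contract` are instances of the Cantor algebra identities. A word `w` is evaluated by an
explicit morphism `w.toMor`, which sends `a u` to `y u` whenever the subword of `w` at the address
`a` is `x α_y` (`HWord.toMor_append`, `HWord.toMor_string`).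

* The evaluation is injective (`StdForm.eval_injective`): if two standard forms have the same
  value, so do their images under each `α_i`; these agree by induction on the word, and an element
  of a Cantor algebra is determined by its images under the `α_i`. Words without `λ`
  are recovered from the value at the empty string.
* It is surjective (`StdForm.eval_surjective`): a total morphism is defined on all strings of some
  length `N`, and by induction on `N` it is built with `λ` from the classes of `u ↦ y u`.

So `Φ` is the inverse of the evaluation. For the correspondence with standard symbols, the addresses
at which a standard form has a subword `x α_y` constitute a maximal prefix code; labelled with the
strings `y` they give a standard symbol that represents the same element (`HWord.leafSymb`).
Conversely, if a standard symbol represents the value of the standard form `w`, then its code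
consists of leaf addresses of `w` with the right labels (`StdForm.subwordAt_of_eval_eq`). Indeed, a
leaf strictly above an element of the code would make the symbol act on a whole cone by
`b u ↦ p u`, and then the siblings of a longest element of the code in this cone could be
contracted (`Symb.eq_of_isStandard_of_cone`).
-/

/-! ### Total morphisms -/

namespace FGMor

variable {n : ℕ}

/-- Equivalent morphisms agree wherever both are defined. -/
theorem Equiv.agree {f g : FGMor n} (h : f.Equiv g) {w v v' : Str n}
    (hf : f.toFun w = some v) (hg : g.toFun w = some v') : v = v' := by
  obtain ⟨u, hu⟩ := (equiv_iff.1 h).1 w v hf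
  rw [g.map_append _ _ u hg] at hu
  exact (List.append_cancel_right (Option.some.inj hu)).symm

/-- A total morphism is defined on all strings of some fixed length. -/
theorem exists_length_defined {f : FGMor n} (h : ∀ w, ∃ u v, f.toFun (w ++ u) = some v) :
    ∃ N : ℕ, ∀ w : Str n, w.length = N → ∃ v, f.toFun w = some v := by
  obtain ⟨S, hS⟩ := f.fg
  refine ⟨S.sup List.length, fun w hw => ?_⟩
  obtain ⟨u, v, huv⟩ := h w
  obtain ⟨x, hx, hp⟩ := (hS _).1 ⟨v, huv⟩
  have hl : x.length ≤ w.length := hw ▸ Finset.le_sup (f := List.length) hx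
  exact (hS w).2 ⟨x, hx, List.prefix_of_prefix_length_le hp (List.prefix_append _ _) hl⟩

end FGMor

/-- The class of the identity map, as an element of the algebra of total maps. -/
def TAlg.one (n : ℕ) : TAlg n := ⟨CMon.one, by
  rw [CMon.one, CMon.star_mk, CMon.mk_eq_iff, FGMor.star_equiv_one_iff]
  exact fun w => ⟨[], w ++ [], rfl⟩⟩

/-! ### Evaluation of words -/

namespace HWord

variable {n : ℕ} {X : Type*}

/-- The value of a word in a Cantor algebra, all variables being sent to `c`. -/
def eval {C : Type*} [CantorAlgebra n C] (c : C) : HWord n X → C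
  | var _ => c
  | app i w => CantorAlgebra.α i (eval c w)
  | lam w => CantorAlgebra.lam fun i => eval c (w i)

theorem eval_alpha {C : Type*} [CantorAlgebra n C] (c : C) (i : Fin n) (w : HWord n X) :
    eval c (alpha i w) = CantorAlgebra.α i (eval c w) := by
  cases w with
  | var x => rfl
  | app j w => rfl
  | lam w => exact (CantorAlgebra.α_lam (fun i => eval c (w i)) i).symm

theorem eval_contract [n.AtLeastTwo] {C : Type*} [CantorAlgebra n C] (c : C)
    (w : Fin n → HWord n X) :
    eval c (contract w) = CantorAlgebra.lam fun i => eval c (w i) := by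
  by_cases h : ∃ u : HWord n X, ∀ i, w i = app i u
  · obtain ⟨u, hu⟩ := h
    obtain rfl : w = fun i => app i u := funext hu
    rw [contract_app]
    exact (CantorAlgebra.lam_α (eval c u)).symm
  · rw [contract_of_not h]
    rfl

/-- The partial map that a word computes when its variables stand for the identity map. -/
def toMor : HWord n X → FGMor n
  | var _ => FGMor.one
  | app i w => FGMor.alpha i (toMor w)
  | lam w => FGMor.lam fun i => toMor (w i)

theorem eval_one_val [n.AtLeastTwo] (w : HWord n X) :
    (eval (TAlg.one n) w).1 = CMon.mk w.toMor := by
  induction w with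
  | var x => rfl
  | app i w ih =>
    change CMon.alpha i (eval (TAlg.one n) w).1 = _
    rw [ih]
    rfl
  | lam w ih =>
    change CMon.lam (fun i => (eval (TAlg.one n) (w i)).1) = _
    simp only [ih]
    exact CMon.lam_mk _

theorem toMor_string (x : X) (v u : Str n) :
    (string x v).toMor.toFun u = some (v ++ u) := by
  induction v using List.reverseRecOn generalizing u with
  | nil => rfl
  | append_singleton v i ih =>
    rw [string_append]
    change (string x v).toMor.toFun (i :: u) = _
    rw [ih, List.append_assoc, List.singleton_append]

theorem string_injective (x : X) : Function.Injective (string (n := n) x) := by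
  intro u v h
  have h1 := toMor_string x u []
  rw [h, toMor_string] at h1
  simpa using h1.symm

theorem toMor_append {w w' : HWord n X} {a : Str n} (h : w.subwordAt a = some w') (u : Str n) :
    w.toMor.toFun (a ++ u) = w'.toMor.toFun u := by
  induction a generalizing w with
  | nil =>
    simp only [subwordAt, Option.some.injEq] at h
    rw [h, List.nil_append]
  | cons i a ih =>
    cases w with
    | var x => cases h
    | app j w => cases h
    | lam w => exact ih (w := w i) h

theorem false_of_lam_eq_string {x : X} {v : Str n} {w : Fin n → HWord n X}
    (h : lam w = string x v) : False := by
  rcases string_cases x v with h' | ⟨_, _, h'⟩ <;> rw [h'] at h <;> cases h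

theorem subwordAt_nil (w : HWord n X) : w.subwordAt [] = some w := by
  cases w <;> rfl

theorem subwordAt_string_cons (x : X) (v : Str n) (i : Fin n) (a : Str n) :
    (string x v).subwordAt (i :: a) = none := by
  rcases string_cases x v with h | ⟨_, _, h⟩ <;> rw [h] <;> rfl

theorem subwordAt_append (w : HWord n X) (a b : Str n) :
    w.subwordAt (a ++ b) = (w.subwordAt a).bind fun w' => w'.subwordAt b := by
  induction a generalizing w with
  | nil => rw [subwordAt_nil, List.nil_append, Option.bind_some]
  | cons i a ih =>
    cases w with
    | var x => rfl
    | app j w => rfl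
    | lam w => exact ih (w i)

theorem IsStandard.of_subwordAt {w w' : HWord n X} (hw : w.IsStandard) {a : Str n}
    (h : w.subwordAt a = some w') : w'.IsStandard := by
  induction a generalizing w with
  | nil =>
    rw [subwordAt_nil] at h
    exact Option.some.inj h ▸ hw
  | cons i a ih =>
    cases hw with
    | string x v =>
      rw [subwordAt_string_cons] at h
      cases h
    | lam w hw hne => exact ih (hw i) h

/-- An address in a standard form either reaches a subword or strictly passes below a leaf. -/
theorem IsStandard.exists_leaf_of_subwordAt_eq_none [Unique X] {w : HWord n X}
    (hw : w.IsStandard) {a : Str n} (h : w.subwordAt a = none) :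
    ∃ b v, b <+: a ∧ b ≠ a ∧ w.subwordAt b = some (HWord.string default v) := by
  induction a generalizing w with
  | nil =>
    rw [subwordAt_nil] at h
    cases h
  | cons i a ih =>
    cases hw with
    | string x v =>
      rw [Unique.eq_default x]
      exact ⟨[], v, List.nil_prefix, by simp, subwordAt_nil _⟩
    | lam w hw hne =>
      obtain ⟨b, v, hb, hne, hv⟩ := ih (hw i) h
      exact ⟨i :: b, v, by simpa using hb, by simpa using hne, hv⟩

end HWord

/-! ### The isomorphism -/

namespace StdForm

variable {n : ℕ} [n.AtLeastTwo] {X : Type*}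

/-- The element of the algebra of total maps that a standard form denotes. -/
noncomputable def eval (w : StdForm n X) : TAlg n := w.1.eval (TAlg.one n)

theorem eval_α (i : Fin n) (w : StdForm n X) :
    eval (CantorAlgebra.α i w) = CantorAlgebra.α i (eval w) := HWord.eval_alpha _ _ _

theorem eval_lam (w : Fin n → StdForm n X) :
    eval (CantorAlgebra.lam w) = CantorAlgebra.lam fun i => eval (w i) :=
  HWord.eval_contract _ _

theorem eval_eq_iff {w w' : StdForm n X} :
    eval w = eval w' ↔ w.1.toMor.Equiv w'.1.toMor := by
  rw [← CMon.mk_eq_iff, ← HWord.eval_one_val, ← HWord.eval_one_val]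
  exact Subtype.ext_iff

theorem ext_α {w w' : StdForm n X}
    (h : ∀ i : Fin n, CantorAlgebra.α i w = CantorAlgebra.α i w') : w = w' := by
  rw [← CantorAlgebra.lam_α (n := n) w, ← CantorAlgebra.lam_α (n := n) w']
  exact congrArg _ (funext h)

theorem eval_injective [Subsingleton X] : Function.Injective (eval : StdForm n X → TAlg n) := by
  rintro ⟨w, hw⟩ w' h
  induction hw generalizing w' with
  | string x v =>
    obtain ⟨w', hw'⟩ := w'
    -- The word `x α_v` may itself be the value of a `λ`, so both sides are pushed down along `α_i`
    -- until the second word has no `λ` left.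
    induction hw' generalizing v with
    | string y v' =>
      have := (eval_eq_iff.1 h).agree (HWord.toMor_string x v []) (HWord.toMor_string y v' [])
      obtain rfl : v = v' := by simpa using this
      obtain rfl := Subsingleton.elim x y
      rfl
    | lam w' hw' hne ih =>
      refine ext_α (n := n) (X := X) fun i => ?_
      let z : StdForm n X := ⟨HWord.string x v, .string x v⟩
      let z' : StdForm n X := ⟨HWord.string x (v ++ [i]), .string _ _⟩
      have hs : CantorAlgebra.α i z = z' :=
        Subtype.ext ((HWord.alpha_string i x v).trans (HWord.string_append x v i).symm)
      refine hs.trans (ih i (v ++ [i]) ?_)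
      exact (congrArg eval hs).symm.trans <|
        (eval_α i z).trans <| (congrArg (CantorAlgebra.α i) h).trans (eval_α i _).symm
  | lam w hw hne ih =>
    refine ext_α (n := n) (X := X) fun i => ih i ?_
    exact (eval_α i ⟨HWord.lam w, .lam w hw hne⟩).trans <|
      (congrArg (CantorAlgebra.α i) h).trans (eval_α i _).symm

theorem eval_surjective [Inhabited X] : Function.Surjective (eval : StdForm n X → TAlg n) := by
  have key : ∀ (N : ℕ) (c : TAlg n) (f : FGMor n), CMon.mk f = c.1 →
      (∀ w : Str n, w.length = N → ∃ v, f.toFun w = some v) → ∃ w : StdForm n X, eval w = c := by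
    intro N
    induction N with
    | zero =>
      intro c f hf hN
      obtain ⟨v, hv⟩ := hN [] rfl
      refine ⟨⟨HWord.string default v, .string _ _⟩, Subtype.ext ?_⟩
      rw [← hf]
      refine (HWord.eval_one_val _).trans (congrArg CMon.mk ?_)
      ext1
      funext u
      rw [HWord.toMor_string]
      exact (f.map_append _ _ u hv).symm
    | succ N ih =>
      intro c f hf hN
      choose w hw using fun i : Fin n => ih (CantorAlgebra.α i c) (f.alpha i)
        ((CMon.alpha_mk i f).symm.trans (congrArg (CMon.alpha i) hf))
        fun u hu => hN (i :: u) (by simp [hu])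
      refine ⟨CantorAlgebra.lam w, ?_⟩
      rw [eval_lam]
      simp only [hw]
      exact CantorAlgebra.lam_α c
  rintro ⟨c, hc⟩
  obtain ⟨f, rfl⟩ := c.exists_rep
  have ht := hc
  rw [CMon.star_mk, CMon.one, CMon.mk_eq_iff, FGMor.star_equiv_one_iff] at ht
  obtain ⟨N, hN⟩ := FGMor.exists_length_defined ht
  exact key N _ f rfl hN

end StdForm

/-- The isomorphism from the algebra of total maps to the algebra of standard forms, inverse to the
evaluation of standard forms. -/
noncomputable def TAlg.isoStdForm (n : ℕ) [n.AtLeastTwo] (X : Type*) [Unique X] :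
    CantorIso n (TAlg n) (StdForm n X) :=
  let e := Equiv.ofBijective (StdForm.eval : StdForm n X → TAlg n)
    ⟨StdForm.eval_injective, StdForm.eval_surjective⟩
  have he : ∀ c, StdForm.eval (e.symm c) = c := e.apply_symm_apply
  { toEquiv := e.symm
    map_α := fun i c => StdForm.eval_injective <|
      (he _).trans ((StdForm.eval_α i (e.symm c)).trans (congrArg _ (he c))).symm
    map_lam := fun c => StdForm.eval_injective <|
      (he _).trans ((StdForm.eval_lam fun i => e.symm (c i)).trans
        (congrArg _ (funext fun i => he (c i)))).symm }

theorem TAlg.eval_isoStdForm {n : ℕ} [n.AtLeastTwo] {X : Type*} [Unique X] (c : TAlg n) :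
    StdForm.eval ((TAlg.isoStdForm n X).toFun c) = c :=
  Equiv.ofBijective_apply_symm_apply (StdForm.eval : StdForm n X → TAlg n)
    ⟨StdForm.eval_injective, StdForm.eval_surjective⟩ c

/-! ### The standard symbol of a standard form -/

namespace HWord

variable {n : ℕ} {X : Type*} [Unique X]

/-- The addresses in `w` at which the subword contains no `λ`, i.e. is of the form `x α_v`. -/
def leaves (w : HWord n X) : Set (Str n) :=
  {a | ∃ v, w.subwordAt a = some (string default v)}

theorem eq_of_prefix_of_mem_leaves {w : HWord n X} {a b : Str n} (ha : a ∈ w.leaves)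
    (hb : b ∈ w.leaves) (h : a <+: b) : a = b := by
  obtain ⟨v, hv⟩ := ha
  obtain ⟨v', hv'⟩ := hb
  obtain ⟨_ | ⟨i, u⟩, rfl⟩ := h
  · simp
  · rw [subwordAt_append, hv, Option.bind_some, subwordAt_string_cons] at hv'
    cases hv'

theorem leaves_string (x : X) (v : Str n) : (string x v).leaves = {[]} := by
  ext a
  rw [Unique.eq_default x]
  rcases a with _ | ⟨i, a⟩
  · exact iff_of_true ⟨v, subwordAt_nil _⟩ rfl
  · simp [leaves, subwordAt_string_cons]

theorem IsStandard.finite_leaves {w : HWord n X} (hw : w.IsStandard) : w.leaves.Finite := by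
  induction hw with
  | string x v =>
    rw [leaves_string]
    exact Set.finite_singleton _
  | lam w hw hne ih =>
    refine (Set.finite_iUnion fun i => (ih i).image (List.cons i)).subset ?_
    rintro (_ | ⟨i, a⟩) ⟨v, hv⟩
    · exact (false_of_lam_eq_string (Option.some.inj hv)).elim
    · exact Set.mem_iUnion.2 ⟨i, a, ⟨v, hv⟩, rfl⟩

theorem IsStandard.exists_comparable_leaf [n.AtLeastTwo] {w : HWord n X} (hw : w.IsStandard)
    (a : Str n) : ∃ b ∈ w.leaves, b <+: a ∨ a <+: b := by
  induction hw generalizing a with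
  | string x v =>
    exact ⟨[], by rw [leaves_string]; rfl, Or.inl List.nil_prefix⟩
  | lam w hw hne ih =>
    have hn : 2 ≤ n := Nat.AtLeastTwo.prop
    rcases a with _ | ⟨i, a⟩
    · obtain ⟨b, hb, -⟩ := ih ⟨0, by omega⟩ []
      exact ⟨⟨0, by omega⟩ :: b, hb, Or.inr List.nil_prefix⟩
    · obtain ⟨b, hb, h⟩ := ih i a
      exact ⟨i :: b, hb, by simpa using h⟩

/-- The symbol of a standard form: the code consists of the leaf addresses, and the label of the
address of a subword `x α_v` is `v`. -/
noncomputable def leafSymb (w : HWord n X) (hw : w.IsStandard) : Symb n where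
  code := hw.finite_leaves.toFinset
  isPrefixCode a ha b hb := eq_of_prefix_of_mem_leaves (by simpa using ha) (by simpa using hb)
  label a := ((Set.Finite.mem_toFinset _).1 a.2).choose

theorem subwordAt_leafSymb {w : HWord n X} {hw : w.IsStandard} {a : Str n}
    (ha : a ∈ (w.leafSymb hw).code) :
    w.subwordAt a = some (HWord.string default ((w.leafSymb hw).label ⟨a, ha⟩)) :=
  ((Set.Finite.mem_toFinset _).1 ha : a ∈ w.leaves).choose_spec

theorem isMaxPrefixCode_leafSymb [n.AtLeastTwo] (w : HWord n X) (hw : w.IsStandard) :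
    IsMaxPrefixCode (w.leafSymb hw).code := by
  refine ⟨(w.leafSymb hw).isPrefixCode, fun a => ?_⟩
  obtain ⟨b, hb, h⟩ := hw.exists_comparable_leaf a
  exact ⟨b, (Set.Finite.mem_toFinset _).2 hb, h⟩

theorem isStandard_leafSymb [n.AtLeastTwo] (w : HWord n X) (hw : w.IsStandard) :
    (w.leafSymb hw).IsStandard := by
  refine ⟨isMaxPrefixCode_leafSymb w hw, ?_⟩
  rintro ⟨x, y, h⟩
  have hi : ∀ i, w.subwordAt (x ++ [i]) = some (app i (HWord.string default y)) := by
    intro i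
    obtain ⟨hc, hl⟩ := h i
    rw [subwordAt_leafSymb hc, hl, string_append]
  have hn : 2 ≤ n := Nat.AtLeastTwo.prop
  cases hx : w.subwordAt x with
  | none =>
    have := hi ⟨0, by omega⟩
    rw [subwordAt_append, hx] at this
    cases this
  | some w' =>
    simp only [subwordAt_append, hx, Option.bind_some] at hi
    cases hw.of_subwordAt hx with
    | string z v =>
      have := hi ⟨0, by omega⟩
      rw [subwordAt_string_cons] at this
      cases this
    | lam w' hw' hne => exact hne ⟨_, fun i => Option.some.inj ((subwordAt_nil (w' i)).symm.trans (hi i))⟩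

/-- Both morphisms agree on the cone below each leaf, and the leaves form a maximal prefix code. -/
theorem toMor_leafSymb_equiv [n.AtLeastTwo] (w : HWord n X) (hw : w.IsStandard) :
    (w.leafSymb hw).toMor.Equiv w.toMor := by
  have hag : ∀ a (ha : a ∈ (w.leafSymb hw).code) (u : Str n),
      w.toMor.toFun (a ++ u) = (w.leafSymb hw).toMor.toFun (a ++ u) := by
    intro a ha u
    rw [toMor_append (subwordAt_leafSymb ha), toMor_string, Symb.toMor_apply _ ha]
  rw [FGMor.equiv_iff]
  constructor
  · intro b v hb
    refine ⟨[], ?_⟩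
    obtain ⟨a, ha, ⟨u, rfl⟩ | ⟨u, rfl⟩⟩ := (isMaxPrefixCode_leafSymb w hw).2 b
    · simpa [hag a ha] using hb
    · -- The symbol is undefined strictly above its code, so here `u` is empty.
      have hb' : ∃ x ∈ (w.leafSymb hw).code, x <+: b := by
        by_contra hcon
        simp [Symb.toMor, hcon] at hb
      obtain ⟨x, hx, u', rfl⟩ := hb'
      simpa [hag x hx] using hb
  · intro b v hb
    obtain ⟨a, ha, ⟨u, rfl⟩ | ⟨u, rfl⟩⟩ := (isMaxPrefixCode_leafSymb w hw).2 b
    · exact ⟨[], by simpa [← hag a ha] using hb⟩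
    · refine ⟨u, ?_⟩
      have := hag _ ha []
      simp only [List.append_nil] at this
      rw [← this]
      exact w.toMor.map_append _ _ _ hb

end HWord

/-! ### Standard symbols represent each element once -/

/-- If a standard symbol acts by `b u ↦ p u` on the part of its code below `b`, then no element of
the code is strictly below `b`: all the siblings of a longest such element would be in the code, and
the symbol could be simplified there. -/
theorem Symb.eq_of_isStandard_of_cone {n : ℕ} {s : Symb n} (hs : s.IsStandard) {b p : Str n}
    (h : ∀ u (hu : b ++ u ∈ s.code), s.label ⟨b ++ u, hu⟩ = p ++ u) {a : Str n}
    (ha : a ∈ s.code) (hb : b <+: a) : b = a := by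
  classical
  by_contra hne
  obtain ⟨x, hx, hmax⟩ := (s.code.filter fun x => b <+: x).exists_max_image List.length
    ⟨a, Finset.mem_filter.2 ⟨ha, hb⟩⟩
  obtain ⟨hxc, u, rfl⟩ := Finset.mem_filter.1 hx
  rcases List.eq_nil_or_concat u with rfl | ⟨t, i, rfl⟩
  · rw [List.append_nil] at hxc
    exact hne (s.isPrefixCode _ hxc _ ha hb)
  refine hs.2 ⟨b ++ t, p ++ t, fun j => ?_⟩
  have hmem : b ++ t ++ [j] ∈ s.code := by
    obtain ⟨z, hz, hzp | hzp⟩ := hs.1.2 (b ++ t ++ [j])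
    · rcases List.prefix_concat_iff.1 hzp with rfl | hzp
      · exact hz
      · have hzx : z <+: b ++ t.concat i := by
          rw [List.concat_eq_append, ← List.append_assoc]
          exact hzp.trans (List.prefix_append _ _)
        have := s.isPrefixCode _ hz _ hxc hzx
        have hl := hzp.length_le
        rw [this] at hl
        simp at hl
    · have hbz : b <+: z := by
        rw [List.append_assoc] at hzp
        exact (List.prefix_append _ _).trans hzp
      have hl := hmax z (Finset.mem_filter.2 ⟨hz, hbz⟩)
      have : b ++ t ++ [j] = z := hzp.eq_of_length_le (by simpa [Nat.add_assoc] using hl)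
      exact this ▸ hz
  refine ⟨hmem, ?_⟩
  have := h (t ++ [j]) (by simpa using hmem)
  simpa using this

namespace StdForm

variable {n : ℕ} [n.AtLeastTwo] {X : Type*}

theorem eval_eq_toTAlg_iff {w : StdForm n X} {s : Symb n} {hs : IsMaxPrefixCode s.code} :
    eval w = s.toTAlg hs ↔ w.1.toMor.Equiv s.toMor := by
  rw [← CMon.mk_eq_iff, ← HWord.eval_one_val]
  exact Subtype.ext_iff

theorem subwordAt_of_eval_eq [Unique X] {w : StdForm n X} {s : Symb n} (hs : s.IsStandard)
    (h : eval w = s.toTAlg hs.1) {a : Str n} (ha : a ∈ s.code) :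
    w.1.subwordAt a = some (HWord.string default (s.label ⟨a, ha⟩)) := by
  rw [eval_eq_toTAlg_iff] at h
  cases hsub : w.1.subwordAt a with
  | none =>
    obtain ⟨b, p, hb, hne, hp⟩ := w.2.exists_leaf_of_subwordAt_eq_none hsub
    refine absurd (Symb.eq_of_isStandard_of_cone hs (p := p) (fun u hu => ?_) ha hb) hne
    refine (h.agree (w := b ++ u) ?_ (by simpa using s.toMor_apply hu [])).symm
    rw [HWord.toMor_append hp, HWord.toMor_string]
  | some w' =>
    -- The subword `w'` and the word `x α_y`, with `y` the label of `a`, have the same value.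
    have hw' := w.2.of_subwordAt hsub
    have heq : eval (⟨w', hw'⟩ : StdForm n X) =
        eval (⟨HWord.string default (s.label ⟨a, ha⟩), .string _ _⟩ : StdForm n X) := by
      refine eval_eq_iff.2 ?_
      rw [FGMor.equiv_iff] at h ⊢
      have hl := fun u => HWord.toMor_append hsub u
      constructor
      · intro u v huv
        have := h.1 (a ++ u) v ((hl u).trans huv)
        simpa only [List.append_assoc, s.toMor_apply ha, HWord.toMor_string] using this
      · intro u v huv
        rw [HWord.toMor_string] at huv
        have := h.2 (a ++ u) v ((s.toMor_apply ha u).trans huv)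
        simpa only [List.append_assoc, hl] using this
    exact congrArg some (Subtype.ext_iff.1 (eval_injective heq))

end StdForm

/-- A standard symbol is determined by the subwords of a standard form that it prescribes: two
maximal prefix codes made of leaf addresses of the same word coincide. -/
theorem StdSymb.ext_of_subwordAt {n : ℕ} {X : Type*} [Unique X] {s t : StdSymb n}
    {w : HWord n X}
    (hs : ∀ a (ha : a ∈ s.1.code),
      w.subwordAt a = some (HWord.string default (s.1.label ⟨a, ha⟩)))
    (ht : ∀ a (ha : a ∈ t.1.code),
      w.subwordAt a = some (HWord.string default (t.1.label ⟨a, ha⟩))) : s = t := by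
  obtain ⟨⟨S, hS, l⟩, hSs⟩ := s
  obtain ⟨⟨T, hT, m⟩, hTs⟩ := t
  obtain rfl : S = T := by
    ext a
    constructor
    · intro ha
      obtain ⟨b, hb, h | h⟩ := hTs.1.2 a
      · exact HWord.eq_of_prefix_of_mem_leaves ⟨_, ht b hb⟩ ⟨_, hs a ha⟩ h ▸ hb
      · exact HWord.eq_of_prefix_of_mem_leaves ⟨_, hs a ha⟩ ⟨_, ht b hb⟩ h ▸ hb
    · intro ha
      obtain ⟨b, hb, h | h⟩ := hSs.1.2 a
      · exact HWord.eq_of_prefix_of_mem_leaves ⟨_, hs b hb⟩ ⟨_, ht a ha⟩ h ▸ hb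
      · exact HWord.eq_of_prefix_of_mem_leaves ⟨_, ht a ha⟩ ⟨_, hs b hb⟩ h ▸ hb
  obtain rfl : l = m := by
    funext ⟨a, ha⟩
    exact HWord.string_injective default (Option.some.inj ((hs a ha).symm.trans (ht a ha)))
  rfl

theorem mainTheorem7 (n : ℕ) [n.AtLeastTwo] {X : Type*} [Unique X] :
    ∃ (Φ : CantorIso n (TAlg n) (StdForm n X)) (Ψ : StdSymb n ≃ StdForm n X),
      (∀ s : StdSymb n, Ψ s = Φ.toFun (s.1.toTAlg s.2.1)) ∧
      (∀ (s : StdSymb n) (a : Str n) (ha : a ∈ s.1.code),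
        (Ψ s).1.subwordAt a = some (HWord.string default (s.1.label ⟨a, ha⟩))) := by
  set Φ := TAlg.isoStdForm n X
  have hsub : ∀ (s : StdSymb n) (a : Str n) (ha : a ∈ s.1.code),
      (Φ.toFun (s.1.toTAlg s.2.1)).1.subwordAt a =
        some (HWord.string default (s.1.label ⟨a, ha⟩)) :=
    fun s a ha => StdForm.subwordAt_of_eval_eq s.2 (TAlg.eval_isoStdForm _) ha
  have hbij : Function.Bijective fun s : StdSymb n => Φ.toFun (s.1.toTAlg s.2.1) := by
    constructor
    · intro s t hst
      refine StdSymb.ext_of_subwordAt (hsub s) fun a ha => ?_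
      rw [← hsub t a ha]
      exact congrArg (fun w : StdForm n X => w.1.subwordAt a) hst
    · intro w
      refine ⟨⟨w.1.leafSymb w.2, HWord.isStandard_leafSymb w.1 w.2⟩, ?_⟩
      apply StdForm.eval_injective
      refine (TAlg.eval_isoStdForm _).trans (Eq.symm ?_)
      exact StdForm.eval_eq_toTAlg_iff.2 (HWord.toMor_leafSymb_equiv w.1 w.2).symm
  exact ⟨Φ, Equiv.ofBijective _ hbij, fun _ => rfl, hsub⟩
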